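/- Let $k$ be a field of characteristic zero and let $X$ be a $k$-variety, i.e. an integral separated scheme of finite type over $k$, with singular locus $\operatorname{Sing} X\subset X$ (the complement of the smooth locus of $X$ over $k$). Let $X_\infty$ be the space of arcs of $X$, i.e. the $k$-scheme whose $K$-valued points, for every field extension $K\supset k$, correspond to the $k$-morphisms $\operatorname{Spec} K[[t]]\to X$ (the $K$-valued arcs of $X$); if $\operatorname{Spec} A\subset X$ is an affine open subscheme, the arcs $\alpha$ with $\alpha(0)\in\operatorname{Spec}A$ form the affine open subscheme of $X_\infty$ given by the spectrum of the $k$-algebra representing $B\mapsto \operatorname{Hom}_k(A,B[[t]])$. Let $0$ and $\eta$ be the closed and the generic point of $\operatorname{Spec}K[[t]]$. A point $x\in X_\infty$ with residue field $\kappa(x)$ gives an arc $\alpha_x:\operatorname{Spec}\kappa(x)[[t]]\to X$; let $\pi:X_\infty\to X$ be the projection, $\pi(x)=\alpha_x(0)$. A $K$-valued arc is called an arc through $\operatorname{Sing}X$ if it maps $0$ into $\operatorname{Sing}X$. An arc $\varphi$ is a specialization of an arc $\psi$ if the point of $X_\infty$ defined by $\varphi$ lies in the closure of the point of $X_\infty$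 defined by $\psi$. Then: (1) For every field extension $K\supset k$, every arc $\varphi:\operatorname{Spec}K[[t]]\to X$ with $\varphi(0)\in\operatorname{Sing}X$ is a specialization of an arc $\psi:\operatorname{Spec}L[[t]]\to X$, for some field extension $L\supset k$, with $\psi(0)\in\operatorname{Sing}X$ and $\psi(\eta)\in X\setminus\operatorname{Sing}X$. (2) Consequently, every irreducible component $C$ of $\pi^{-1}(\operatorname{Sing}X)\subset X_\infty$ is good, i.e. it contains a point $x$ with $\alpha_x(\eta)\notin\operatorname{Sing}X$. -/

import Mathlib

universe u

namespace ArcSpace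

noncomputable section

open PowerSeries

section Algebra

variable {R A : Type u} [CommRing R] [CommRing A]

/-- The relations defining the Hasse–Schmidt algebra of `φ : R →+* A` on the generators
`D n a = X (n, a)`: the map `a ↦ ∑ (D n a) tⁿ` is a ring homomorphism which sends
the elements of `R` to constants. -/
inductive HSRel (φ : R →+* A) : MvPolynomial (ℕ × A) ℤ → MvPolynomial (ℕ × A) ℤ → Prop
  | one : HSRel φ (MvPolynomial.X (0, 1)) 1
  | add (n : ℕ) (a b : A) : HSRel φ (MvPolynomial.X (n, a + b))
      (MvPolynomial.X (n, a) + MvPolynomial.X (n, b))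
  | mul (n : ℕ) (a b : A) : HSRel φ (MvPolynomial.X (n, a * b))
      (∑ p ∈ Finset.HasAntidiagonal.antidiagonal n, MvPolynomial.X (p.1, a) * MvPolynomial.X (p.2, b))
  | const (n : ℕ) (hn : n ≠ 0) (c : R) : HSRel φ (MvPolynomial.X (n, φ c)) 0

/-- The ideal generated by the Hasse–Schmidt relations. -/
def hsIdeal (φ : R →+* A) : Ideal (MvPolynomial (ℕ × A) ℤ) :=
  Ideal.span {x | ∃ p q, HSRel φ p q ∧ p - q = x}

/-- The Hasse–Schmidt algebra of `φ : R →+* A`: the coordinate ring of the space of arcs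
of `Spec A` over `R`. It represents `B ↦ Hom_R(A, B⟦t⟧)`, see `HSAlgebra.lift`. -/
def HSAlgebra (φ : R →+* A) : Type u :=
  MvPolynomial (ℕ × A) ℤ ⧸ hsIdeal φ

instance (φ : R →+* A) : CommRing (HSAlgebra φ) :=
  inferInstanceAs (CommRing (_ ⧸ hsIdeal φ))

namespace HSAlgebra

variable (φ : R →+* A)

/-- The `n`-th coefficient of the universal arc at `a`. -/
def D (n : ℕ) (a : A) : HSAlgebra φ :=
  Ideal.Quotient.mk (hsIdeal φ) (MvPolynomial.X (n, a))

lemma mk_eq_of_rel {p q : MvPolynomial (ℕ × A) ℤ} (h : HSRel φ p q) :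
    (Ideal.Quotient.mk (hsIdeal φ) p : HSAlgebra φ) = Ideal.Quotient.mk (hsIdeal φ) q :=
  Ideal.Quotient.eq.mpr (Ideal.subset_span ⟨p, q, h, rfl⟩)

lemma D_zero_one : D φ 0 1 = 1 := mk_eq_of_rel φ .one

lemma D_add (n : ℕ) (a b : A) : D φ n (a + b) = D φ n a + D φ n b :=
  mk_eq_of_rel φ (.add n a b)

lemma D_mul (n : ℕ) (a b : A) :
    D φ n (a * b) = ∑ p ∈ Finset.HasAntidiagonal.antidiagonal n, D φ p.1 a * D φ p.2 b :=
  (mk_eq_of_rel φ (.mul n a b)).trans (map_sum (Ideal.Quotient.mk (hsIdeal φ)) _ _)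

lemma D_const {n : ℕ} (hn : n ≠ 0) (c : R) : D φ n (φ c) = 0 := mk_eq_of_rel φ (.const n hn c)

/-- The universal arc `A → (HSAlgebra φ)⟦t⟧`, `a ↦ ∑ (D n a) tⁿ`. -/
def univ : A →+* (HSAlgebra φ)⟦X⟧ where
  toFun a := PowerSeries.mk fun n ↦ D φ n a
  map_zero' := by
    ext n
    simpa using D_add φ n 0 0
  map_one' := by
    ext n
    rw [coeff_mk, coeff_one]
    split_ifs with h
    · subst h; exact D_zero_one φ
    · simpa using D_const φ h 1
  map_add' a b := by ext n; simp [D_add]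
  map_mul' a b := by ext n; simp [D_mul, coeff_mul]

@[simp] lemma coeff_univ (n : ℕ) (a : A) : coeff n (univ φ a) = D φ n a := by
  simp [univ]

variable {φ} {B : Type u} [CommRing B]

/-- The homomorphism `HSAlgebra φ → B` classifying an arc `A → B⟦t⟧` over `R`. -/
def lift (f : A →+* B⟦X⟧) (hf : ∀ n ≠ 0, ∀ c, coeff n (f (φ c)) = 0) :
    HSAlgebra φ →+* B :=
  Ideal.Quotient.lift (hsIdeal φ) (MvPolynomial.eval₂Hom (Int.castRingHom B) fun p ↦ coeff p.1 (f p.2)) <| by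
    intro x hx
    rw [← RingHom.mem_ker]
    refine Ideal.span_le.mpr ?_ hx
    rintro _ ⟨p, q, h, rfl⟩
    simp only [SetLike.mem_coe, RingHom.mem_ker, map_sub, sub_eq_zero]
    induction h with
    | one => simp
    | add n a b => simp
    | mul n a b => simp [coeff_mul]
    | const n hn c => simpa using hf n hn c

@[simp] lemma lift_D (f : A →+* B⟦X⟧) (hf : ∀ n ≠ 0, ∀ c, coeff n (f (φ c)) = 0) (n : ℕ) (a : A) :
    lift f hf (D φ n a) = coeff n (f a) := by
  exact (Ideal.Quotient.lift_mk (hsIdeal φ) _ _).trans (by simp)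

lemma hom_ext {f g : HSAlgebra φ →+* B} (h : ∀ n a, f (D φ n a) = g (D φ n a)) : f = g := by
  refine Ideal.Quotient.ringHom_ext (MvPolynomial.ringHom_ext (fun n ↦ by simp) ?_)
  rintro ⟨n, a⟩
  exact h n a

lemma map_lift_comp_univ (f : A →+* B⟦X⟧) (hf : ∀ n ≠ 0, ∀ c, coeff n (f (φ c)) = 0) :
    (PowerSeries.map (lift f hf)).comp (univ φ) = f := by
  ext a n
  simp

lemma coeff_map_univ (h : HSAlgebra φ →+* B) {n : ℕ} (hn : n ≠ 0) (c : R) :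
    coeff n ((PowerSeries.map h).comp (univ φ) (φ c)) = 0 := by
  simp [D_const φ hn]

/-- The structure map `A → HSAlgebra φ`, which is dual to taking the base point of an arc. -/
def base (φ : R →+* A) : A →+* HSAlgebra φ := constantCoeff.comp (univ φ)

@[simp] lemma base_apply (a : A) : base φ a = D φ 0 a := by
  simp [base, ← coeff_zero_eq_constantCoeff_apply]

/-- Functoriality of the Hasse–Schmidt algebra. -/
def map {A' : Type u} [CommRing A'] (ψ : R →+* A') (r : A →+* A')
    (hr : r.comp φ = ψ) : HSAlgebra φ →+* HSAlgebra ψ :=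
  lift ((univ ψ).comp r) fun n hn c ↦ by
    have := congr($hr c)
    simp only [RingHom.comp_apply] at this
    simp [this, D_const ψ hn]

@[simp] lemma map_D {A' : Type u} [CommRing A'] (ψ : R →+* A') (r : A →+* A')
    (hr : r.comp φ = ψ) (n : ℕ) (a : A) : map ψ r hr (D φ n a) = D ψ n (r a) := by
  simp [map]

lemma map_eq_id (r : A →+* A) (hr : r.comp φ = φ) (h : r = .id A) : map φ r hr = .id _ :=
  hom_ext fun n a ↦ by simp [h]

lemma map_eq_comp {A' A'' : Type u} [CommRing A'] [CommRing A''] {ψ : R →+* A'} {χ : R →+* A''}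
    (r : A →+* A') (hr : r.comp φ = ψ) (r' : A' →+* A'') (hr' : r'.comp ψ = χ)
    (t : A →+* A'') (ht : t.comp φ = χ) (h : t = r'.comp r) :
    map χ t ht = (map χ r' hr').comp (map ψ r hr) :=
  hom_ext fun n a ↦ by simp [h]

lemma map_base {A' : Type u} [CommRing A'] (ψ : R →+* A') (r : A →+* A')
    (hr : r.comp φ = ψ) (a : A) : map ψ r hr (base φ a) = base ψ (r a) := by
  simp

/-- The Hasse–Schmidt algebra commutes with localization. -/
lemma isLocalization_map {A' : Type u} [CommRing A'] (ψ : R →+* A') (r : A →+* A')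
    (hr : r.comp φ = ψ) (a : A)
    (H : letI := r.toAlgebra; IsLocalization.Away a A') :
    letI := (map ψ r hr).toAlgebra
    IsLocalization.Away (base φ a) (HSAlgebra ψ) := by
  let _ := r.toAlgebra
  let _ := (map ψ r hr).toAlgebra
  have : IsLocalization.Away a A' := H
  let L := Localization.Away (base φ a)
  have hu : IsUnit (map ψ r hr (base φ a)) := by
    have h1 : IsUnit (r a) := IsLocalization.Away.algebraMap_isUnit (S := A') a
    simpa using h1.map (base ψ)
  let f : L →+* HSAlgebra ψ := IsLocalization.Away.lift (base φ a) hu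
  let g₀ : A →+* L⟦X⟧ := (PowerSeries.map (algebraMap (HSAlgebra φ) L)).comp (univ φ)
  have hg₀ : IsUnit (g₀ a) := by
    rw [PowerSeries.isUnit_iff_constantCoeff]
    have := IsLocalization.Away.algebraMap_isUnit (S := L) (base φ a)
    simpa [g₀, ← coeff_zero_eq_constantCoeff_apply] using this
  let g₁ : A' →+* L⟦X⟧ := IsLocalization.Away.lift a hg₀
  have hg₁ (x : A) : g₁ (r x) = g₀ x := IsLocalization.Away.lift_eq (S := A') a hg₀ x
  let g : HSAlgebra ψ →+* L := lift g₁ fun n hn c ↦ by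
    rw [← hr, RingHom.comp_apply, hg₁]
    exact coeff_map_univ _ hn c
  have hf (x) : f (algebraMap _ L x) = map ψ r hr x := IsLocalization.Away.lift_eq _ hu x
  have hg (x) : g (map ψ r hr x) = algebraMap _ L x := by
    suffices g.comp (map ψ r hr) = algebraMap _ L from congr($this x)
    refine hom_ext fun n b ↦ ?_
    simp [g, hg₁, g₀]
  have hgf : g.comp f = .id L := by
    refine IsLocalization.ringHom_ext (Submonoid.powers (base φ a)) ?_
    ext x
    simp [hf, hg]
  have hfg : f.comp g = .id _ := by
    suffices (PowerSeries.map f).comp g₁ = univ ψ by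
      refine hom_ext fun n b ↦ ?_
      have := congr(coeff n ($this b))
      simpa [g] using this
    refine IsLocalization.ringHom_ext (Submonoid.powers a) ?_
    ext x n
    change coeff n ((PowerSeries.map f) (g₁ (r x))) = coeff n (univ ψ (r x))
    simp [hg₁, g₀, hf]
  let e : L ≃ₐ[HSAlgebra φ] HSAlgebra ψ :=
    { RingEquiv.ofRingHom f g hfg hgf with commutes' := hf }
  exact IsLocalization.isLocalization_of_algEquiv _ e

end HSAlgebra

end Algebra

section Scheme

open AlgebraicGeometry CategoryTheory Limits Scheme.AffineZariskiSite

variable {R : Type u} [CommRing R] {X : Scheme.{u}} (s : X ⟶ Spec (.of R))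

/-- The `R`-algebra structure on the sections of an `R`-scheme. -/
def structMap (U : X.Opens) : R →+* Γ(X, U) :=
  ((Scheme.ΓSpecIso (.of R)).inv ≫ s.appTop ≫ X.presheaf.map (homOfLE le_top).op).hom

lemma map_comp_structMap {U V : X.Opensᵒᵖ} (i : U ⟶ V) :
    (X.presheaf.map i).hom.comp (structMap s U.unop) = structMap s V.unop := by
  rw [structMap, ← CommRingCat.hom_comp, Category.assoc, Category.assoc, ← Functor.map_comp]
  rfl

lemma fromSpec_comp {U : X.Opens} (hU : IsAffineOpen U) :
    hU.fromSpec ≫ s = Spec.map (CommRingCat.ofHom (structMap s U)) := by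
  have h := IsAffineOpen.SpecMap_appLE_fromSpec s (isAffineOpen_top (Spec (.of R))) hU le_top
  rw [← h, IsAffineOpen.fromSpec_top, structMap, CommRingCat.ofHom_hom, Spec.map_comp,
    Scheme.isoSpec_Spec_inv]
  rfl

/-- The presheaf `U ↦ HS(Γ(X, U))` of Hasse–Schmidt algebras. -/
def hsPresheaf : X.Opensᵒᵖ ⥤ CommRingCat.{u} where
  obj U := .of (HSAlgebra (structMap s U.unop))
  map i := CommRingCat.ofHom (HSAlgebra.map _ (X.presheaf.map i).hom (map_comp_structMap s i))
  map_id U := CommRingCat.hom_ext <|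
    HSAlgebra.map_eq_id _ (map_comp_structMap s (𝟙 U)) congr(($(X.presheaf.map_id U)).hom)
  map_comp i j := CommRingCat.hom_ext <|
    HSAlgebra.map_eq_comp _ (map_comp_structMap s i) _ (map_comp_structMap s j) _
      (map_comp_structMap s (i ≫ j))
      congr(($(X.presheaf.map_comp i j)).hom)

/-- The structure map `𝒪_X → HS`. -/
def hsPresheafBase : X.presheaf ⟶ hsPresheaf s where
  app U := CommRingCat.ofHom (HSAlgebra.base (structMap s U.unop))
  naturality U V i := by
    refine CommRingCat.hom_ext (RingHom.ext fun x ↦ ?_)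
    exact (HSAlgebra.map_base _ _ (map_comp_structMap s i) x).symm

lemma coequifibered_hsPresheafBase :
    ((toOpensFunctor X).op.whiskerLeft (hsPresheafBase s)).Coequifibered := by
  refine coequifibered_iff_forall_isLocalizationAway.mpr fun U r ↦ ?_
  exact HSAlgebra.isLocalization_map _ _ (map_comp_structMap s (homOfLE (X.basicOpen_le r)).op) r
    (U.2.isLocalization_basicOpen r)

/-- The diagram of affine schemes `Spec HS(Γ(X, U))`, for `U ⊆ X` affine open, which are glued
to form the space of arcs. -/
def glueData := relativeGluingData (coequifibered_hsPresheafBase s)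

instance : ((glueData s).functor ⋙ Scheme.forget).IsLocallyDirected :=
  Scheme.Cover.RelativeGluingData.instIsLocallyDirectedI₀CompFunctorForgetOfIsThin ..

/-- The space of arcs `X_∞` of an `R`-scheme `X`. -/
def arcSpace : Scheme.{u} := (glueData s).glued

/-- The projection `π : X_∞ ⟶ X`, sending an arc `α` to `α(0)`. -/
def proj : arcSpace s ⟶ X := (glueData s).toBase

/-- The open subscheme `Spec HS(Γ(X, U)) ⟶ X_∞` of arcs centered in the affine open `U`. -/
def chart {U : X.Opens} (hU : IsAffineOpen U) :
    Spec (.of (HSAlgebra (structMap s U))) ⟶ arcSpace s :=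
  (glueData s).cover.f ⟨U, hU⟩

instance {U : X.Opens} (hU : IsAffineOpen U) : IsOpenImmersion (chart s hU) :=
  (glueData s).cover.map_prop ⟨U, hU⟩

lemma chart_proj {U : X.Opens} (hU : IsAffineOpen U) :
    chart s hU ≫ proj s = Spec.map (CommRingCat.ofHom (HSAlgebra.base _)) ≫ hU.fromSpec :=
  colimit.ι_desc _ _

lemma range_chart {U : X.Opens} (hU : IsAffineOpen U) :
    Set.range (chart s hU) = proj s ⁻¹' U := by
  have := (glueData s).preimage_toBase_eq_range_ι ⟨U, hU⟩
  rw [show Set.range ((directedCover X).f ⟨U, hU⟩) = U from Scheme.Opens.range_ι U] at this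
  exact this.symm

/-- The restriction map `HS(Γ(X, U)) → HS(Γ(X, V))`. -/
def hsRes {U V : X.Opens} (i : V ≤ U) : HSAlgebra (structMap s U) →+* HSAlgebra (structMap s V) :=
  HSAlgebra.map _ _ (map_comp_structMap s (homOfLE i).op)

lemma hsRes_D {U V : X.Opens} (i : V ≤ U) (n : ℕ) (a : Γ(X, U)) :
    hsRes s i (HSAlgebra.D _ n a) = HSAlgebra.D _ n (X.presheaf.map (homOfLE i).op a) :=
  HSAlgebra.map_D _ _ (map_comp_structMap s (homOfLE i).op) n a

/-- Compatibility of the charts. -/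
lemma hsRes_chart {U V : X.Opens} (hU : IsAffineOpen U) (hV : IsAffineOpen V) (i : V ≤ U)
    (h : ∃ f : Γ(X, U), X.basicOpen f = V) :
    Spec.map (CommRingCat.ofHom (hsRes s i)) ≫ chart s hU = chart s hV :=
  colimit.w (glueData s).functor (CategoryTheory.homOfLE (X := X.AffineZariskiSite)
    (x := ⟨V, hV⟩) (y := ⟨U, hU⟩) h)

section Arcs

lemma exists_affine_mem (x : X) : ∃ U : X.Opens, IsAffineOpen U ∧ x ∈ U := by
  obtain ⟨U, hU⟩ := TopologicalSpace.Opens.mem_iSup.mp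
    ((iSup_affineOpens_eq_top X).ge (Set.mem_univ x))
  exact ⟨U.1, U.2, hU⟩

variable (K : Type u) [Field K]

/-- The unique point of `Spec K`. -/
def fieldPt : Spec (.of K) := IsLocalRing.closedPoint K

/-- The closed point `0` of `Spec K⟦t⟧`. -/
def closedPt : Spec (.of K⟦X⟧) := IsLocalRing.closedPoint K⟦X⟧

/-- The generic point `η` of `Spec K⟦t⟧`. -/
def genericPt : Spec (.of K⟦X⟧) := (⊥ : PrimeSpectrum K⟦X⟧)

lemma specMap_constantCoeff :
    Spec.map (CommRingCat.ofHom (constantCoeff (R := K))) (fieldPt K) = closedPt K := by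
  have : IsLocalHom (constantCoeff (R := K)) :=
    ⟨fun f hf ↦ PowerSeries.isUnit_iff_constantCoeff.mpr hf⟩
  exact IsLocalRing.comap_closedPoint (constantCoeff (R := K))

variable {s K}

/-- A `K`-valued arc which is centered in an affine open `U` is given by a ring homomorphism. -/
lemma exists_arc_factor (φ : Spec (.of K⟦X⟧) ⟶ X) {U : X.Opens} (hU : IsAffineOpen U)
    (h : φ (closedPt K) ∈ U) :
    ∃ f : Γ(X, U) →+* K⟦X⟧, Spec.map (CommRingCat.ofHom f) ≫ hU.fromSpec = φ := by
  have h : Set.range φ ⊆ Set.range hU.fromSpec := by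
    rw [IsAffineOpen.range_fromSpec]
    rintro _ ⟨x, rfl⟩
    exact ((IsLocalRing.specializes_closedPoint x).map φ.continuous).mem_open U.2 h
  refine ⟨(Spec.preimage (IsOpenImmersion.lift hU.fromSpec φ h)).hom, ?_⟩
  rw [CommRingCat.ofHom_hom, Spec.map_preimage, IsOpenImmersion.lift_fac]

/-- A `K`-valued point of `X_∞` over an affine open `U` is given by a ring homomorphism. -/
lemma exists_hom_factor (g : Spec (.of K) ⟶ arcSpace s) {U : X.Opens} (hU : IsAffineOpen U)
    (h : (g ≫ proj s) (fieldPt K) ∈ U) :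
    ∃ h : HSAlgebra (structMap s U) →+* K, Spec.map (CommRingCat.ofHom h) ≫ chart s hU = g := by
  have h : Set.range g ⊆ Set.range (chart s hU) := by
    rw [range_chart]
    rintro _ ⟨x, rfl⟩
    rw [Subsingleton.elim (α := PrimeSpectrum K) x (fieldPt K)]
    exact h
  refine ⟨(Spec.preimage (IsOpenImmersion.lift (chart s hU) g h)).hom, ?_⟩
  rw [CommRingCat.ofHom_hom, Spec.map_preimage, IsOpenImmersion.lift_fac]

/-- The `K`-valued point of `X_∞` given by a point of a chart. -/
def localHom {U : X.Opens} (hU : IsAffineOpen U) (h : HSAlgebra (structMap s U) →+* K) :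
    Spec (.of K) ⟶ arcSpace s :=
  Spec.map (CommRingCat.ofHom h) ≫ chart s hU

/-- The arc `Spec K⟦t⟧ ⟶ Spec Γ(X, U) ⟶ X` given by a point of a chart. -/
def localArc {U : X.Opens} (hU : IsAffineOpen U) (h : HSAlgebra (structMap s U) →+* K) :
    Spec (.of K⟦X⟧) ⟶ X :=
  Spec.map (CommRingCat.ofHom ((PowerSeries.map h).comp (HSAlgebra.univ _))) ≫ hU.fromSpec

/-- The arc and the point of `X_∞` have the same center. -/
lemma localArc_center {U : X.Opens} (hU : IsAffineOpen U) (h : HSAlgebra (structMap s U) →+* K) :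
    Spec.map (CommRingCat.ofHom (constantCoeff (R := K))) ≫ localArc hU h =
      localHom hU h ≫ proj s := by
  rw [localArc, localHom, Category.assoc, chart_proj, ← Spec.map_comp_assoc,
    ← Spec.map_comp_assoc, ← CommRingCat.ofHom_comp, ← CommRingCat.ofHom_comp]
  congr 3

lemma localArc_closedPoint {U : X.Opens} (hU : IsAffineOpen U)
    (h : HSAlgebra (structMap s U) →+* K) :
    localArc hU h (closedPt K) =
      (localHom hU h ≫ proj s) (fieldPt K) := by
  rw [← localArc_center, Scheme.Hom.comp_apply, specMap_constantCoeff]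

lemma localArc_mem {U : X.Opens} (hU : IsAffineOpen U) (h : HSAlgebra (structMap s U) →+* K) :
    localArc hU h (closedPt K) ∈ U := by
  rw [← SetLike.mem_coe, ← hU.range_fromSpec, localArc, Scheme.Hom.comp_apply]
  exact ⟨_, rfl⟩

lemma localHom_res {U V : X.Opens} (hU : IsAffineOpen U) (hV : IsAffineOpen V) (i : V ≤ U)
    (hi : ∃ f : Γ(X, U), X.basicOpen f = V) (h : HSAlgebra (structMap s V) →+* K) :
    localHom hU (h.comp (hsRes s i)) = localHom hV h := by
  rw [localHom, localHom, CommRingCat.ofHom_comp, Spec.map_comp, Category.assoc,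
    hsRes_chart s hU hV i hi]

lemma localArc_res {U V : X.Opens} (hU : IsAffineOpen U) (hV : IsAffineOpen V) (i : V ≤ U)
    (h : HSAlgebra (structMap s V) →+* K) :
    localArc hU (h.comp (hsRes s i)) = localArc hV h := by
  rw [localArc, localArc, ← IsAffineOpen.map_fromSpec hU hV (homOfLE i).op,
    ← Spec.map_comp_assoc]
  congr 2
  refine CommRingCat.hom_ext (RingHom.ext fun a ↦ PowerSeries.ext fun n ↦ ?_)
  simp [hsRes_D]

lemma localHom_injective {U : X.Opens} (hU : IsAffineOpen U)
    {h h' : HSAlgebra (structMap s U) →+* K} (e : localHom hU h = localHom hU h') : h = h' := by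
  rw [localHom, localHom, cancel_mono] at e
  exact congr(($(Spec.map_injective e)).hom)

lemma localArc_injective {U : X.Opens} (hU : IsAffineOpen U)
    {h h' : HSAlgebra (structMap s U) →+* K} (e : localArc hU h = localArc hU h') : h = h' := by
  rw [localArc, localArc, cancel_mono] at e
  refine HSAlgebra.hom_ext fun n a ↦ ?_
  simpa using congr(coeff n (($(Spec.map_injective e)).hom a))

/-- Any two charts around the center have a common refinement. -/
lemma exists_refine {x : X} {U V : X.Opens} (hU : IsAffineOpen U) (hV : IsAffineOpen V)
    (hxU : x ∈ U) (hxV : x ∈ V) :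
    ∃ (W : X.Opens) (_ : IsAffineOpen W) (_ : W ≤ U) (_ : W ≤ V), x ∈ W ∧
      (∃ f : Γ(X, U), X.basicOpen f = W) ∧ (∃ f : Γ(X, V), X.basicOpen f = W) := by
  obtain ⟨f, g, e, hxf⟩ := exists_basicOpen_le_affine_inter hU hV _ ⟨hxU, hxV⟩
  exact ⟨X.basicOpen f, hU.basicOpen f, X.basicOpen_le f, e.le.trans (X.basicOpen_le g), hxf,
    ⟨f, rfl⟩, ⟨g, e.symm⟩⟩

lemma exists_localHom_res {U V : X.Opens} (hU : IsAffineOpen U) (hV : IsAffineOpen V) (i : V ≤ U)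
    (hi : ∃ f : Γ(X, U), X.basicOpen f = V) (h : HSAlgebra (structMap s U) →+* K)
    (hm : localArc hU h (closedPt K) ∈ V) :
    ∃ h' : HSAlgebra (structMap s V) →+* K, h = h'.comp (hsRes s i) := by
  obtain ⟨h', hh'⟩ := exists_hom_factor (localHom hU h) hV (by rwa [← localArc_closedPoint])
  refine ⟨h', localHom_injective hU ?_⟩
  rw [localHom_res hU hV i hi]
  exact hh'.symm

/-- Two points of charts give the same point of `X_∞` iff they give the same arc. -/
lemma localHom_eq_iff {U V : X.Opens} (hU : IsAffineOpen U) (hV : IsAffineOpen V)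
    {h : HSAlgebra (structMap s U) →+* K} {h' : HSAlgebra (structMap s V) →+* K} :
    localHom hU h = localHom hV h' ↔ localArc hU h = localArc hV h' := by
  have key (H : localArc hU h (closedPt K) =
      localArc hV h' (closedPt K)) :
      localHom hU h = localHom hV h' ↔ localArc hU h = localArc hV h' := by
    obtain ⟨W, hW, i, j, hxW, hi, hj⟩ := exists_refine hU hV (localArc_mem hU h)
      (H ▸ localArc_mem hV h')
    obtain ⟨g, rfl⟩ := exists_localHom_res hU hW i hi h hxW
    obtain ⟨g', rfl⟩ := exists_localHom_res hV hW j hj h' (H ▸ hxW)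
    rw [localHom_res hU hW i hi, localHom_res hV hW j hj, localArc_res hU hW, localArc_res hV hW]
    exact ⟨fun e ↦ by rw [localHom_injective hW e], fun e ↦ by rw [localArc_injective hW e]⟩
  refine ⟨fun e ↦ (key ?_).mp e, fun e ↦ (key ?_).mpr e⟩
  · rw [localArc_closedPoint, localArc_closedPoint, e]
  · rw [e]

lemma exists_localHom (g : Spec (.of K) ⟶ arcSpace s) :
    ∃ (U : X.Opens) (hU : IsAffineOpen U) (h : HSAlgebra (structMap s U) →+* K),
      localHom hU h = g := by
  obtain ⟨U, hU, hx⟩ := exists_affine_mem ((g ≫ proj s) (fieldPt K))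
  exact ⟨U, hU, exists_hom_factor g hU hx⟩

/-- The arc `Spec K⟦t⟧ ⟶ X` corresponding to a `K`-valued point of the space of arcs. -/
def arcOfHom (g : Spec (.of K) ⟶ arcSpace s) : Spec (.of K⟦X⟧) ⟶ X :=
  localArc (exists_localHom g).choose_spec.choose (exists_localHom g).choose_spec.choose_spec.choose

lemma arcOfHom_localHom {U : X.Opens} (hU : IsAffineOpen U) (h : HSAlgebra (structMap s U) →+* K) :
    arcOfHom (localHom hU h) = localArc hU h :=
  (localHom_eq_iff _ _).mp (exists_localHom (localHom hU h)).choose_spec.choose_spec.choose_spec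

variable (s K) in
/-- A `K`-valued arc of the `R`-scheme `X`: an `R`-morphism `Spec K⟦t⟧ ⟶ X`. -/
structure Arc [Algebra R K] where
  /-- The underlying morphism of schemes. -/
  hom : Spec (.of K⟦X⟧) ⟶ X
  hom_comp : hom ≫ s = Spec.map (CommRingCat.ofHom (algebraMap R K⟦X⟧))

/-- Every `K`-valued arc of `X` corresponds to a unique `K`-valued point of `X_∞`. -/
lemma Arc.existsUnique_hom [Algebra R K] (φ : Arc s K) :
    ∃! g : Spec (.of K) ⟶ arcSpace s, arcOfHom g = φ.hom := by
  obtain ⟨U, hU, hx⟩ := exists_affine_mem (φ.hom (closedPt K))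
  obtain ⟨f, hf⟩ := exists_arc_factor φ.hom hU hx
  have hfc (c : R) : f (structMap s U c) = algebraMap R K⟦X⟧ c := by
    have := φ.hom_comp
    rw [← hf, Category.assoc, fromSpec_comp, ← Spec.map_comp] at this
    exact congr(($(Spec.map_injective this)).hom c)
  let h := HSAlgebra.lift f (φ := structMap s U) fun n hn c ↦ by
    rw [hfc, PowerSeries.algebraMap_apply, coeff_C, if_neg hn]
  have hh : localArc hU h = φ.hom := by
    rw [localArc, HSAlgebra.map_lift_comp_univ, hf]
  refine ⟨localHom hU h, (arcOfHom_localHom hU h).trans hh, fun g hg ↦ ?_⟩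
  obtain ⟨V, hV, h', rfl⟩ := exists_localHom g
  rw [localHom_eq_iff, hh, ← hg, arcOfHom_localHom]

/-- Every `K`-valued point of `X_∞` over `R` corresponds to a `K`-valued arc of `X`. -/
lemma arcOfHom_over [Algebra R K] (g : Spec (.of K) ⟶ arcSpace s)
    (hg : g ≫ proj s ≫ s = Spec.map (CommRingCat.ofHom (algebraMap R K))) :
    arcOfHom g ≫ s = Spec.map (CommRingCat.ofHom (algebraMap R K⟦X⟧)) := by
  obtain ⟨V, hV, h, rfl⟩ := exists_localHom g
  rw [← Category.assoc, ← localArc_center, Category.assoc] at hg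
  rw [arcOfHom_localHom]
  rw [localArc, Category.assoc, fromSpec_comp, ← Spec.map_comp] at hg ⊢
  rw [← Spec.map_comp] at hg
  congr 1
  refine CommRingCat.hom_ext (RingHom.ext fun c ↦ PowerSeries.ext fun n ↦ ?_)
  by_cases hn : n = 0
  · subst hn
    have := congr(($(Spec.map_injective hg)).hom c)
    simpa [PowerSeries.algebraMap_apply, ← coeff_zero_eq_constantCoeff_apply] using this
  · simp [HSAlgebra.D_const _ hn, PowerSeries.algebraMap_apply, coeff_C, hn]

lemma arcOfHom_specMap {L : Type u} [Field L] (j : K →+* L) (g : Spec (.of K) ⟶ arcSpace s) :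
    arcOfHom (Spec.map (CommRingCat.ofHom j) ≫ g) =
      Spec.map (CommRingCat.ofHom (PowerSeries.map j)) ≫ arcOfHom g := by
  obtain ⟨V, hV, h, rfl⟩ := exists_localHom g
  have : Spec.map (CommRingCat.ofHom j) ≫ localHom hV h = localHom hV (j.comp h) := by
    rw [localHom, localHom, ← Spec.map_comp_assoc, CommRingCat.ofHom_comp]
  rw [this, arcOfHom_localHom, arcOfHom_localHom, localArc, localArc, ← Spec.map_comp_assoc,
    ← CommRingCat.ofHom_comp]
  congr 3

lemma arcOfHom_closedPt (g : Spec (.of K) ⟶ arcSpace s) :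
    arcOfHom g (closedPt K) = proj s (g (fieldPt K)) := by
  obtain ⟨V, hV, h, rfl⟩ := exists_localHom g
  rw [arcOfHom_localHom, localArc_closedPoint, Scheme.Hom.comp_apply]

/-- The point of `X_∞` given by an arc of `X`. -/
def Arc.point [Algebra R K] (φ : Arc s K) : arcSpace s :=
  φ.existsUnique_hom.choose (fieldPt K)

/-- The arc `α_x : Spec κ(x)⟦t⟧ ⟶ X` given by a point `x` of `X_∞` with residue field `κ(x)`. -/
def arcAt (x : arcSpace s) : Spec (.of ((arcSpace s).residueField x)⟦X⟧) ⟶ X :=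
  arcOfHom ((arcSpace s).fromSpecResidueField x)

/-- `π(x) = α_x(0)`. -/
lemma arcAt_closedPt (x : arcSpace s) : arcAt x (closedPt _) = proj s x :=
  (arcOfHom_closedPt _).trans congr(proj s $(Scheme.fromSpecResidueField_apply x _))

lemma Arc.proj_point [Algebra R K] (φ : Arc s K) : proj s φ.point = φ.hom (closedPt K) := by
  rw [Arc.point, ← arcOfHom_closedPt, φ.existsUnique_hom.choose_spec.1]

/-- An arc is obtained from the arc of its point in `X_∞` by extending the field. -/
lemma Arc.exists_hom_eq [Algebra R K] (φ : Arc s K) :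
    ∃ j : (arcSpace s).residueField φ.point →+* K,
      φ.hom = Spec.map (CommRingCat.ofHom (PowerSeries.map j)) ≫ arcAt φ.point := by
  let g := φ.existsUnique_hom.choose
  have hg : arcOfHom g = φ.hom := φ.existsUnique_hom.choose_spec.1
  let j := (Scheme.descResidueField (Scheme.stalkClosedPointTo g))
  have hj : Spec.map j ≫ (arcSpace s).fromSpecResidueField _ = g :=
    Scheme.descResidueField_stalkClosedPointTo_fromSpecResidueField K _ g
  refine ⟨j.hom, ?_⟩
  exact hg.symm.trans ((congrArg arcOfHom hj.symm).trans
    (arcOfHom_specMap j.hom ((arcSpace s).fromSpecResidueField φ.point)))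

end Arcs

section Singular

variable {k : Type u} [Field k] {X : Scheme.{u}} (s : X ⟶ Spec (.of k)) [LocallyOfFiniteType s]

/-- The singular locus of a scheme locally of finite type over a field `k`: the complement of
the smooth locus. -/
def sing : Set X :=
  haveI : LocallyOfFinitePresentation s :=
    LocallyOfFinitePresentation.iff_locallyOfFiniteType.mpr inferInstance
  (s.smoothLocus : Set X)ᶜ

/-- The space `π⁻¹(Sing X) ⊆ X_∞` of arcs through `Sing X`. -/
def arcsThroughSing : Set (arcSpace s) := proj s ⁻¹' sing s

variable {s} in
/-- A set of arcs through `Sing X` (in particular, an irreducible component of the space of such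
arcs) is good if it has a point `x` with `α_x(η) ∉ Sing X`. -/
def IsGood (C : Set (arcsThroughSing s)) : Prop :=
  ∃ x ∈ C, arcAt x.1 (genericPt _) ∉ sing s

end Singular

end Scheme

end

end ArcSpace

/-! In characteristic zero the generic point of the variety is smooth. So if an arc φ maps η into
Sing X, then in an affine chart Spec A around φ(0) it is a ring map f : A → K⟦t⟧ with nonzero kernel
p. It suffices to deform f to an injective arc centered at the point p = φ(η): its generic point is
then the generic point of X, and its center lies in Sing X.

Some injective arc g : A → κ⟦s⟧ has center p: dominate A at p by a discrete valuation ring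
(`exists_dvr_dominating`) and complete (`exists_dvr_to_powerSeries`). To connect g with f, replace f
by its Taylor expansion f(u + t), an arc over K⟦u⟧ ⊂ Frac K⟦u⟧. Its center is f(u), whose kernel is
p, and it specializes to f at u = 0.

Frac K⟦u⟧ and κ embed compatibly over A/p into a field M. By formal smoothness of field extensions
in characteristic zero, Taylor expansion extends to E : M → M⟦t⟧. Then M⟦s⟧ → M[x]⟦t⟧, given by E on
M and s ↦ xt, turns g into a family of arcs over the affine line. At x = 0 it is the expansion f(u +
t); over M(x) it is injective. Setting x = 0 and then u = 0 gives the required specialization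
(`exists_dominant_generalization`). Part (2) follows by applying (1) to the generic point of a
component. -/

namespace ArcSpace

open PowerSeries

/-! ### Evaluation, lifting and Taylor expansion of power series -/

section PowerSeries

/-- Evaluation of power series at an element of an ideal `I`, in an `I`-adically complete ring. -/
theorem exists_powerSeries_eval {R S : Type*} [CommRing R] [CommRing S] (I : Ideal S)
    [IsAdicComplete I S] (φ : R →+* S) {x : S} (hx : x ∈ I) :
    ∃ G : R⟦X⟧ →+* S, (∀ a, G (C a) = φ a) ∧ G X = x := by
  -- Since x ∈ I, terms of degree at least n vanish modulo I ^ n. Hence evaluating truncations is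
  -- multiplicative modulo I ^ n.
  have key (n : ℕ) (p : Polynomial R) :
      Ideal.Quotient.mk (I ^ n) ((trunc n (p : R⟦X⟧)).eval₂ φ x) =
        Ideal.Quotient.mk (I ^ n) (p.eval₂ φ x) := by
    have hd : Polynomial.X ^ n ∣ p - trunc n (p : R⟦X⟧) := by
      rw [Polynomial.X_pow_dvd_iff]
      intro d hd
      rw [Polynomial.coeff_sub, coeff_trunc, if_pos hd, Polynomial.coeff_coe, sub_self]
    obtain ⟨q, hq⟩ := hd
    rw [eq_comm, Ideal.Quotient.eq, ← Polynomial.eval₂_sub, hq, Polynomial.eval₂_mul,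
      Polynomial.eval₂_X_pow]
    exact Ideal.mul_mem_right _ _ (Ideal.pow_mem_pow hx n)
  let f (n : ℕ) : R⟦X⟧ →+* S ⧸ I ^ n :=
    { toFun g := Ideal.Quotient.mk (I ^ n) ((trunc n g).eval₂ φ x)
      map_one' := by
        have := key n 1
        rwa [Polynomial.coe_one, Polynomial.eval₂_one,
          map_one (Ideal.Quotient.mk (I ^ n))] at this
      map_zero' := by simp
      map_add' a b := by simp [Polynomial.eval₂_add]
      map_mul' a b := by
        rw [← trunc_trunc_mul_trunc, ← Polynomial.coe_mul, key, Polynomial.eval₂_mul, map_mul] }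
  have hf {m n : ℕ} (hle : m ≤ n) :
      (Ideal.Quotient.factorPow I hle).comp (f n) = f m := by
    ext g
    change Ideal.Quotient.mk (I ^ m) ((trunc n g).eval₂ φ x) =
      Ideal.Quotient.mk (I ^ m) ((trunc m g).eval₂ φ x)
    rw [← key m (trunc n g), trunc_trunc_of_le _ hle]
  have hG (g : R⟦X⟧) (y : S) (h : ∀ n, f n g = Ideal.Quotient.mk (I ^ n) y) :
      IsAdicComplete.liftRingHom I f hf g = y := by
    rw [← sub_eq_zero]
    refine IsHausdorff.haus (I := I) inferInstance _ fun n ↦ ?_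
    rw [smul_eq_mul, Ideal.mul_top, SModEq.zero, ← Ideal.Quotient.eq, ← h]
    exact IsAdicComplete.mk_liftRingHom I f hf n g
  refine ⟨IsAdicComplete.liftRingHom I f hf, fun a ↦ hG _ _ fun n ↦ ?_, hG _ _ fun n ↦ ?_⟩
  · have := key n (Polynomial.C a)
    rwa [Polynomial.coe_C, Polynomial.eval₂_C] at this
  · have := key n Polynomial.X
    rwa [Polynomial.coe_X, Polynomial.eval₂_X] at this

/-- L is algebraic, hence separable in characteristic zero, over the purely transcendental extension
generated by a transcendence basis. -/
lemma formallySmooth_of_charZero (F L : Type*) [Field F] [CharZero F] [Field L] [Algebra F L] :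
    Algebra.FormallySmooth F L := by
  obtain ⟨s, hs⟩ := exists_isTranscendenceBasis F L
  have := hs.isAlgebraic_field
  have : CharZero (IntermediateField.adjoin F (Set.range ((↑) : s → L))) :=
    charZero_of_injective_algebraMap (algebraMap F _).injective
  exact .of_algebraicIndependent_of_isSeparable hs.1

/-- A ring homomorphism `F → L⟦t⟧` which reduces to a field extension `F ⊆ L` in characteristic
zero extends to `L`. -/
theorem exists_extend_to_powerSeries {F L : Type*} [Field F] [CharZero F] [Field L] [Algebra F L]
    (T : F →+* L⟦X⟧) (hT : (constantCoeff (R := L)).comp T = algebraMap F L) :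
    ∃ E : L →+* L⟦X⟧, E.comp (algebraMap F L) = T ∧ (constantCoeff (R := L)).comp E = .id L := by
  -- The target is kept abstract so that T can serve as its F-algebra structure; L⟦X⟧ already
  -- carries the one through constants.
  have key {S : Type _} [CommRing S] (I : Ideal S) [IsAdicComplete I S] (T : F →+* S)
      (g : L →+* S ⧸ I) (h : g.comp (algebraMap F L) = (Ideal.Quotient.mk I).comp T) :
      ∃ E : L →+* S, E.comp (algebraMap F L) = T ∧ (Ideal.Quotient.mk I).comp E = g := by
    algebraize [T]
    have := formallySmooth_of_charZero F L
    let g' : L →ₐ[F] S ⧸ I := { g with commutes' a := congr($h a) }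
    obtain ⟨E, hE⟩ := Algebra.FormallySmooth.exists_mkₐ_comp_eq_of_isAdicComplete g'
    exact ⟨E, RingHom.ext fun a ↦ E.commutes a, RingHom.ext fun a ↦ congr($hE a)⟩
  have hX (f g : L⟦X⟧) : Ideal.Quotient.mk (Ideal.span {X}) f = Ideal.Quotient.mk _ g ↔
      constantCoeff f = constantCoeff g := by
    rw [Ideal.Quotient.eq, Ideal.mem_span_singleton, X_dvd_iff, map_sub, sub_eq_zero]
  obtain ⟨E, h1, h2⟩ := key (Ideal.span {(X : L⟦X⟧)}) T ((Ideal.Quotient.mk _).comp C)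
    (RingHom.ext fun a ↦ by
      simpa [hX] using congr($hT a).symm)
  exact ⟨E, h1, RingHom.ext fun a ↦ by simpa [hX] using congr($h2 a)⟩

open Finset in
/-- The Taylor expansion `f(x) ↦ f(x + t)`. -/
noncomputable def taylorHom (R : Type*) [CommRing R] : R⟦X⟧ →+* R⟦X⟧⟦X⟧ where
  -- The outer index n is the power of the new variable t, the inner index m the power of the old
  -- one.
  toFun f := .mk fun n ↦ .mk fun m ↦ ((m + n).choose n : R) * coeff (m + n) f
  map_one' := by
    ext n m
    simp only [coeff_mk, coeff_one]
    by_cases hn : n = 0 <;> by_cases hm : m = 0 <;> simp [hn, hm, coeff_one]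
  map_zero' := by ext; simp
  map_add' f g := by ext; simp [mul_add]
  map_mul' f g := by
    ext n m
    rw [coeff_mul, map_sum]
    simp only [coeff_mk, coeff_mul]
    -- Vandermonde's identity, applied to each splitting of m + n.
    have hV (p : ℕ × ℕ) (hp : p ∈ antidiagonal (m + n)) :
        (((m + n).choose n : ℕ) : R) =
          ∑ q ∈ antidiagonal n, (p.1.choose q.1 * p.2.choose q.2 : R) := by
      rw [← HasAntidiagonal.mem_antidiagonal.mp hp, Nat.add_choose_eq]
      push_cast
      rfl
    rw [mul_sum, sum_congr rfl fun p hp ↦ by rw [hV p hp, sum_mul], sum_comm]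
    refine sum_congr rfl fun q hq ↦ ?_
    rw [HasAntidiagonal.mem_antidiagonal] at hq
    -- Shift the index pair by q. Pairs outside the image have a component smaller than that of q,
    -- so a binomial coefficient vanishes.
    refine (sum_of_injOn (fun c ↦ (c.1 + q.1, c.2 + q.2)) ?_ ?_ ?_ ?_).symm
    · rintro ⟨a, b⟩ - ⟨c, d⟩ - h
      simpa using h
    · rintro ⟨a, b⟩ h
      simp only [mem_coe, HasAntidiagonal.mem_antidiagonal] at h ⊢
      lia
    · rintro ⟨i, j⟩ hij h
      rw [HasAntidiagonal.mem_antidiagonal] at hij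
      have : i < q.1 ∨ j < q.2 := by
        by_contra! hc
        refine h ⟨(i - q.1, j - q.2), ?_, ?_⟩
        · simp only [mem_coe, HasAntidiagonal.mem_antidiagonal]
          dsimp only at hij hc
          lia
        · simp [Nat.sub_add_cancel hc.1, Nat.sub_add_cancel hc.2]
      rcases this with h | h <;> simp [Nat.choose_eq_zero_of_lt h]
    · rintro ⟨a, b⟩ -
      ring

@[simp] lemma taylorHom_C {R : Type*} [CommRing R] (a : R) : taylorHom R (C a) = C (C a) := by
  ext n m
  simp only [taylorHom, RingHom.coe_mk, MonoidHom.coe_mk, OneHom.coe_mk, coeff_mk, coeff_C]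
  by_cases hn : n = 0 <;> by_cases hm : m = 0 <;> simp [hn, hm, coeff_C]

@[simp] lemma constantCoeff_taylorHom {R : Type*} [CommRing R] (f : R⟦X⟧) :
    constantCoeff (taylorHom R f) = f := by
  ext n
  simp [taylorHom, ← coeff_zero_eq_constantCoeff_apply]

@[simp] lemma map_constantCoeff_taylorHom {R : Type*} [CommRing R] (f : R⟦X⟧) :
    PowerSeries.map (constantCoeff (R := R)) (taylorHom R f) = f := by
  ext n
  simp [taylorHom, ← coeff_zero_eq_constantCoeff_apply]

end PowerSeries

/-! ### The family of arcs over an affine line -/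

section Family

@[simp] lemma constantCoeff_map {R S : Type*} [CommRing R] [CommRing S] (f : R →+* S) (a : R⟦X⟧) :
    constantCoeff (PowerSeries.map f a) = f (constantCoeff a) := by
  simp only [← coeff_zero_eq_constantCoeff_apply, coeff_map]

open scoped TensorProduct in
/-- Two fields over a ring with the same kernel have a common extension. -/
theorem exists_field_amalgam {A : Type*} {F κ : Type u} [CommRing A] [Field F] [Field κ]
    (f : A →+* F) (g : A →+* κ) (h : RingHom.ker f = RingHom.ker g) :
    ∃ (M : Type u) (_ : Field M) (i : F →+* M) (l : κ →+* M), i.comp f = l.comp g := by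
  have hp : (RingHom.ker f).IsPrime := RingHom.ker_isPrime f
  let f' := Ideal.ResidueField.lift (RingHom.ker f) f le_rfl fun x hx ↦ by
    simpa [IsUnit.mem_submonoid_iff] using hx
  let g' := Ideal.ResidueField.lift (RingHom.ker f) g h.le fun x hx ↦ by
    have hx' : x ∉ RingHom.ker g := h ▸ hx
    simpa [IsUnit.mem_submonoid_iff] using hx'
  let _ := f'.toAlgebra
  let _ := g'.toAlgebra
  -- A tensor product of two extensions of a field is nonzero; any residue field of it contains
  -- both.
  obtain ⟨m, hm⟩ := Ideal.exists_maximal (F ⊗[(RingHom.ker f).ResidueField] κ)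
  refine ⟨_ ⧸ m, Ideal.Quotient.field m,
    (Ideal.Quotient.mk m).comp Algebra.TensorProduct.includeLeftRingHom,
    (Ideal.Quotient.mk m).comp (Algebra.TensorProduct.includeRight
      (R := (RingHom.ker f).ResidueField) (A := F) (B := κ)).toRingHom, RingHom.ext fun a ↦ ?_⟩
  have h1 : f'  (algebraMap A (RingHom.ker f).ResidueField a) = f a :=
    Ideal.ResidueField.lift_algebraMap ..
  have h2 : g'  (algebraMap A (RingHom.ker f).ResidueField a) = g a :=
    Ideal.ResidueField.lift_algebraMap ..
  simp only [RingHom.comp_apply, Algebra.TensorProduct.includeLeftRingHom_apply]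
  rw [← h1, ← h2]
  refine congrArg (Ideal.Quotient.mk m) ?_
  have := TensorProduct.smul_tmul (R := (RingHom.ker f).ResidueField)
    (algebraMap A (RingHom.ker f).ResidueField a) (1 : F) (1 : κ)
  simp only [Algebra.smul_def, mul_one] at this
  exact this

/-- The Taylor expansion extends to the fraction field, and to every field extension of it. -/
theorem exists_taylor_extension (R : Type*) {M : Type*} [CommRing R] [IsDomain R] [CharZero R]
    [Field M] (i : R⟦X⟧ →+* M) (hi : Function.Injective i) :
    ∃ E : M →+* M⟦X⟧, E.comp i = (PowerSeries.map i).comp (taylorHom R) ∧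
      (constantCoeff (R := M)).comp E = .id M := by
  let F := FractionRing R⟦X⟧
  have : CharZero R⟦X⟧ := charZero_of_injective_ringHom (C_injective (R := R))
  have : CharZero F := charZero_of_injective_algebraMap (IsFractionRing.injective R⟦X⟧ F)
  let i' : F →+* M := IsFractionRing.lift hi
  let T₀ := (PowerSeries.map i).comp (taylorHom R)
  have hT₀ (a : R⟦X⟧) : constantCoeff (T₀ a) = i a := by
    simp [T₀]
  -- At t = 0 the expansion of a is i a, so nonzero elements become units in M⟦t⟧.
  let T : F →+* M⟦X⟧ := IsLocalization.lift (M := nonZeroDivisors R⟦X⟧) (g := T₀) fun a ↦ by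
    rw [PowerSeries.isUnit_iff_constantCoeff, hT₀, isUnit_iff_ne_zero]
    exact (map_ne_zero_iff i hi).mpr (nonZeroDivisors.coe_ne_zero a)
  have hT (a : R⟦X⟧) : T (algebraMap _ F a) = T₀ a := IsLocalization.lift_eq _ a
  have hi' (a : R⟦X⟧) : i' (algebraMap _ F a) = i a := IsFractionRing.lift_algebraMap hi a
  algebraize [i']
  obtain ⟨E, h1, h2⟩ := exists_extend_to_powerSeries (F := F) (L := M) T
    (IsLocalization.ringHom_ext (nonZeroDivisors R⟦X⟧) <| RingHom.ext fun a ↦ by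
      simp only [RingHom.comp_apply, hT, hT₀]
      exact (hi' a).symm)
  refine ⟨E, RingHom.ext fun a ↦ ?_, h2⟩
  change _ = T₀ a
  rw [← hT, ← h1, RingHom.comp_apply, RingHom.comp_apply, ← hi' a]
  rfl

/-- A ring homomorphism `E : M → M⟦t⟧` extends to `M⟦s⟧ → M[x]⟦t⟧` with `s ↦ x t`. -/
theorem exists_family {M : Type*} [Field M] (E : M →+* M⟦X⟧) :
    ∃ G : M⟦X⟧ →+* (Polynomial M)⟦X⟧, Function.Injective G ∧
      (∀ a, G (C a) = PowerSeries.map Polynomial.C (E a)) ∧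
      (∀ a, constantCoeff (G a) = Polynomial.C (constantCoeff (E (constantCoeff a)))) ∧
      ∀ a, PowerSeries.map (Polynomial.evalRingHom 0) (G a) = E (constantCoeff a) := by
  -- The factor t makes the substitution s ↦ xt converge t-adically, with polynomials in x as
  -- coefficients.
  obtain ⟨G, h1, h2⟩ := exists_powerSeries_eval (Ideal.span {(X : (Polynomial M)⟦X⟧)})
    ((PowerSeries.map Polynomial.C).comp E) (x := C Polynomial.X * X)
    (Ideal.mul_mem_left _ _ (Ideal.mem_span_singleton_self X))
  -- Split a = c + s b with c constant. The image of s b is a multiple of xt, so it dies both at t =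
  -- 0 and at x = 0.
  have h3 (a : M⟦X⟧) : ∃ b, G a =
      PowerSeries.map Polynomial.C (E (constantCoeff a)) + C Polynomial.X * X * b := by
    obtain ⟨b, hb⟩ : X ∣ a - C (constantCoeff a) := by simp [X_dvd_iff]
    refine ⟨G b, ?_⟩
    rw [← h2, ← RingHom.comp_apply, ← h1, ← map_mul, ← map_add, ← hb, add_sub_cancel]
  refine ⟨G, ?_, h1, fun a ↦ ?_, fun a ↦ ?_⟩
  · rw [injective_iff_map_eq_zero]
    intro a ha
    by_contra h0
    obtain ⟨n, u, rfl⟩ := IsDiscreteValuationRing.eq_unit_mul_pow_irreducible h0 X_irreducible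
    rw [map_mul, map_pow, h2] at ha
    exact mul_ne_zero (u.isUnit.map G).ne_zero
      (pow_ne_zero n (mul_ne_zero
        ((map_ne_zero_iff C C_injective).mpr Polynomial.X_ne_zero) X_ne_zero)) ha
  · obtain ⟨b, hb⟩ := h3 a
    rw [hb]
    simp
  · obtain ⟨b, hb⟩ := h3 a
    rw [hb, map_add, map_mul, map_mul, map_C]
    ext n
    simp

/-- Let `f : A → K⟦t⟧` be an arc and `g : A → κ⟦s⟧` an injective arc centered at the kernel of `f`.
The Taylor expansion of `f` lies in a family of injective arcs with the same center, parametrized by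
an affine line. -/
theorem exists_generalization {k : Type*} {A K κ : Type u} [Field k] [CharZero k] [CommRing A]
    [Algebra k A] [Field K] [Algebra k K] [Field κ] [Algebra k κ] (f : A →ₐ[k] K⟦X⟧)
    (g : A →ₐ[k] κ⟦X⟧)
    (hg : Function.Injective g) (h : ∀ a, constantCoeff (g a) = 0 ↔ f a = 0) :
    ∃ (M : Type u) (_ : Field M) (_ : Algebra k M) (i : K⟦X⟧ →+* M)
      (ψ : A →ₐ[k] (Polynomial M)⟦X⟧), Function.Injective i ∧ Function.Injective ψ ∧
      (∀ a, constantCoeff (ψ a) = 0 ↔ f a = 0) ∧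
      (PowerSeries.map (Polynomial.evalRingHom 0)).comp (ψ : A →+* _) =
        ((PowerSeries.map i).comp (taylorHom K)).comp (f : A →+* _) := by
  have : CharZero K := charZero_of_injective_algebraMap (algebraMap k K).injective
  let F := FractionRing K⟦X⟧
  -- The generic point of f and the center of g are the same point of Spec A, which makes the two
  -- fields compatible.
  obtain ⟨M, _, i₀, l, hil⟩ := exists_field_amalgam ((algebraMap K⟦X⟧ F).comp (f : A →+* _))
    ((constantCoeff (R := κ)).comp (g : A →+* _)) (by
      ext a
      simp [RingHom.mem_ker, h])
  let i := i₀.comp (algebraMap K⟦X⟧ F)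
  have hi : Function.Injective i := i₀.injective.comp (IsFractionRing.injective _ _)
  obtain ⟨E, hE, hE'⟩ := exists_taylor_extension K i hi
  obtain ⟨G, G1, G2, G3, G4⟩ := exists_family E
  have hE'' (a) : constantCoeff (E a) = a := congr($hE' a)
  have hil' (a) : i (f a) = l (constantCoeff (g a)) := congr($hil a)
  -- M becomes a k-algebra through K⟦X⟧. The map l respects this because both k-structures factor
  -- through A.
  algebraize [i.comp (algebraMap k K⟦X⟧)]
  have hk (c : k) : algebraMap k M c = i (algebraMap k K⟦X⟧ c) := rfl
  have hl (c : k) : l (algebraMap k κ c) = algebraMap k M c := by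
    rw [hk, ← f.commutes, hil', g.commutes, PowerSeries.algebraMap_apply, constantCoeff_C]
  have hEk (c : k) : E (algebraMap k M c) = algebraMap k M⟦X⟧ c := by
    have := congr($hE (C (algebraMap k K c)))
    simp only [RingHom.comp_apply, taylorHom_C, map_C] at this
    rw [hk, PowerSeries.algebraMap_apply, PowerSeries.algebraMap_apply, this, hk,
      PowerSeries.algebraMap_apply]
  let ψ : A →ₐ[k] (Polynomial M)⟦X⟧ :=
    { (G.comp (PowerSeries.map l)).comp (g : A →+* _) with
      commutes' c := by
        simp [PowerSeries.algebraMap_apply, hl, G2, hEk, Polynomial.algebraMap_apply] }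
  have hψ (a) : ψ a = G (PowerSeries.map l (g a)) := rfl
  refine ⟨M, inferInstance, inferInstance, i, ψ, hi,
    G1.comp ((PowerSeries.map_injective l l.injective).comp hg), fun a ↦ ?_,
    RingHom.ext fun a ↦ ?_⟩
  · rw [hψ, G3, ← h, hE'']
    simp
  · simp only [RingHom.comp_apply, AlgHom.coe_toRingHom, hψ]
    rw [G4, constantCoeff_map, ← hil', ← RingHom.comp_apply, hE, RingHom.comp_apply]

end Family

/-! ### Injective arcs with a prescribed center, from discrete valuation rings -/

section DVR

open IsLocalRing

/-- A discrete valuation ring containing a field of characteristic zero embeds into the ring of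
power series over a field. -/
theorem exists_dvr_to_powerSeries (k : Type*) (W : Type u) [Field k] [CharZero k] [CommRing W]
    [IsDomain W] [IsDiscreteValuationRing W] [Algebra k W] :
    ∃ (κ : Type u) (_ : Field κ) (_ : Algebra k κ) (g : W →ₐ[k] κ⟦X⟧), Function.Injective g ∧
      ∀ w, constantCoeff (g w) = 0 ↔ w ∈ maximalIdeal W := by
  let S := AdicCompletion (maximalIdeal W) W
  let κ := S ⧸ maximalIdeal S
  let _ : Field κ := Ideal.Quotient.field _
  have := formallySmooth_of_charZero k κ
  -- Lifting the identity of κ gives a coefficient field in the completion, as in Cohen's structure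
  -- theorem.
  obtain ⟨σ, hσ⟩ := Algebra.FormallySmooth.exists_mkₐ_comp_eq_of_isAdicComplete
    (AlgHom.id k κ)
  obtain ⟨ϖ, hϖ⟩ := IsDiscreteValuationRing.exists_irreducible W
  have hm : maximalIdeal S = Ideal.span {algebraMap W S ϖ} := by
    refine AdicCompletion.maximalIdeal_eq_map.trans ?_
    rw [congrArg (Ideal.map (algebraMap W S)) hϖ.maximalIdeal_eq, Ideal.map_span,
      Set.image_singleton]
  have hinj : Function.Injective (algebraMap W S) := AdicCompletion.of_injective _ _
  obtain ⟨G, G1, G2⟩ := exists_powerSeries_eval (maximalIdeal S) (σ : κ →+* S)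
    (x := algebraMap W S ϖ) (hm ▸ Ideal.mem_span_singleton_self _)
  have hmap : (Ideal.span {(X : κ⟦X⟧)}).map G = maximalIdeal S := by
    rw [Ideal.map_span, Set.image_singleton, G2, hm]
  -- By completeness it is enough to be surjective modulo X, where σ provides the lifts.
  have Gs : Function.Surjective G := by
    have : IsHausdorff ((Ideal.span {(X : κ⟦X⟧)}).map G) S := by
      rw [hmap]; infer_instance
    refine surjective_of_mk_map_comp_surjective (I := Ideal.span {(X : κ⟦X⟧)}) G ?_
    rw [hmap]
    intro y
    refine ⟨C y, ?_⟩
    rw [RingHom.comp_apply, G1]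
    exact congr($hσ y)
  -- A nonzero series is a unit times a power of X, so an element of the kernel would force a power
  -- of ϖ to vanish already in W.
  have Gi : Function.Injective G := by
    rw [injective_iff_map_eq_zero]
    intro a ha
    by_contra h0
    obtain ⟨n, u, rfl⟩ := IsDiscreteValuationRing.eq_unit_mul_pow_irreducible h0 X_irreducible
    rw [map_mul, map_pow, G2, (u.isUnit.map G).mul_right_eq_zero, ← map_pow,
      map_eq_zero_iff _ hinj] at ha
    exact pow_ne_zero n hϖ.ne_zero ha
  let e := RingEquiv.ofBijective G ⟨Gi, Gs⟩
  have he (a) : G (e.symm a) = a := e.apply_symm_apply a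
  refine ⟨κ, inferInstance, inferInstance, { (e.symm : S →+* κ⟦X⟧).comp (algebraMap W S) with
    commutes' c := ?_ }, e.symm.injective.comp hinj, fun w ↦ ?_⟩
  · apply Gi
    refine (he _).trans ?_
    rw [PowerSeries.algebraMap_apply, G1]
    exact (σ.commutes c).symm
  · change constantCoeff (e.symm (algebraMap W S w)) = 0 ↔ _
    rw [← not_iff_not, ← ne_eq, ← isUnit_iff_ne_zero, ← PowerSeries.isUnit_iff_constantCoeff,
      MulEquiv.isUnit_map, isUnit_map_iff, mem_maximalIdeal, mem_nonunits_iff, not_not]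

/-- By Noether normalization A is integral over a polynomial ring P, so the integral closure of A in
Q is that of P. As P is normal and Q is finite separable over Frac P, the integral closure is
noetherian. -/
theorem isNoetherianRing_integralClosure (k A Q : Type*) [Field k] [CharZero k] [CommRing A]
    [IsDomain A] [Algebra k A] [Algebra.FiniteType k A] [Field Q] [Algebra A Q]
    [IsFractionRing A Q] : IsNoetherianRing (integralClosure A Q) := by
  obtain ⟨s, g, hg, hg'⟩ := exists_integral_inj_algHom_of_fg k A
  let P := MvPolynomial (Fin s) k
  let _ : Algebra P A := (g : P →+* A).toAlgebra
  let _ : Algebra P Q := ((algebraMap A Q).comp (g : P →+* A)).toAlgebra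
  have : IsScalarTower P A Q := .of_algebraMap_eq fun _ ↦ rfl
  have : IsScalarTower k P A := .of_algebraMap_eq fun c ↦ (g.commutes c).symm
  let _ : Algebra k Q := ((algebraMap A Q).comp (algebraMap k A)).toAlgebra
  have : IsScalarTower k A Q := .of_algebraMap_eq fun _ ↦ rfl
  have : IsScalarTower k P Q := .of_algebraMap_eq fun c ↦
    congrArg (algebraMap A Q) (g.commutes c).symm
  have : FaithfulSMul P A := (faithfulSMul_iff_algebraMap_injective _ _).mpr hg
  have : FaithfulSMul P Q := .trans P A Q
  let _ := FractionRing.liftAlgebra P Q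
  have : Algebra.IsIntegral P A := ⟨hg'⟩
  have : Algebra.IsAlgebraic (FractionRing P) Q := by
    have : Algebra.IsAlgebraic A Q :=
      (IsFractionRing.comap_isAlgebraic_iff (A := A) (K := Q) (C := Q)).mpr inferInstance
    have : Algebra.IsAlgebraic P Q := .trans P A Q
    exact (IsFractionRing.comap_isAlgebraic_iff (A := P)).mp this
  have : Algebra.EssFiniteType k Q :=
    have : Algebra.EssFiniteType A Q := .of_isLocalization _ (nonZeroDivisors A)
    .comp k A Q
  have : IsScalarTower k (FractionRing P) Q := .of_algebraMap_eq fun c ↦ by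
    rw [IsScalarTower.algebraMap_apply k P (FractionRing P), ← IsScalarTower.algebraMap_apply P,
      ← IsScalarTower.algebraMap_apply k]
  have : Algebra.EssFiniteType (FractionRing P) Q := .of_comp k _ _
  have : FiniteDimensional (FractionRing P) Q := Algebra.finite_of_essFiniteType_of_isAlgebraic
  have : CharZero (FractionRing P) :=
    charZero_of_injective_algebraMap (algebraMap k (FractionRing P)).injective
  have : IsIntegralClosure (integralClosure A Q) P Q :=
    ⟨Subtype.val_injective, fun {x} ↦ ⟨fun h ↦ ⟨⟨x, h.tower_top⟩, rfl⟩, by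
      rintro ⟨y, rfl⟩
      exact isIntegral_trans (R := P) (A := A) _ y.2⟩⟩
  exact IsIntegralClosure.isNoetherianRing P (FractionRing P) Q _

/-- A noetherian normal domain is dominated by a discrete valuation ring at a minimal prime of a
nonzero principal ideal. -/
theorem exists_dvr_of_mem_minimalPrimes {B : Type u} [CommRing B] [IsDomain B] [IsNoetherianRing B]
    [IsIntegrallyClosed B] {x : B} (hx : x ≠ 0) (q : Ideal B)
    (hq : q ∈ (Ideal.span {x}).minimalPrimes) :
    ∃ (W : Type u) (_ : CommRing W) (_ : IsDomain W) (_ : IsDiscreteValuationRing W) (g : B →+* W),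
      Function.Injective g ∧ ∀ b, g b ∈ maximalIdeal W ↔ b ∈ q := by
  have : q.IsPrime := hq.1.1
  have hxq : x ∈ q := hq.1.2 (Ideal.mem_span_singleton_self x)
  have hf := IsLocalization.AtPrime.not_isField B (P := q) (fun h ↦ hx (by simpa [h] using hxq))
    (Localization.AtPrime q)
  -- Krull's principal ideal theorem. The localization at q is then local, noetherian, normal and of
  -- dimension one.
  have h1 : q.height ≤ 1 := Ideal.height_le_one_of_isPrincipal_of_mem_minimalPrimes _ q hq
  have : Ring.KrullDimLE 1 (Localization.AtPrime q) := by
    rw [Ring.krullDimLE_iff, IsLocalization.AtPrime.ringKrullDim_eq_height q]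
    exact_mod_cast h1
  have hic : IsIntegrallyClosed (Localization.AtPrime q) :=
    isIntegrallyClosed_of_isLocalization _ q.primeCompl q.primeCompl_le_nonZeroDivisors
  have hdvr := (IsDiscreteValuationRing.TFAE _ hf).out 0 3
  refine ⟨Localization.AtPrime q, inferInstance, inferInstance, hdvr.mpr ⟨hic, maximalIdeal _,
    ⟨isField_iff_maximalIdeal_eq.not.mp hf, inferInstance⟩, fun P hP ↦ ?_⟩, algebraMap B _,
    IsLocalization.injective _ q.primeCompl_le_nonZeroDivisors,
    IsLocalization.AtPrime.to_map_mem_maximal_iff _ q⟩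
  exact eq_maximalIdeal (Ring.krullDimLE_one_iff_of_isPrime_bot.mp ‹_› P hP.1 hP.2)

/-- Every nonzero prime of a domain of finite type over a field of characteristic zero is dominated
by a discrete valuation ring. -/
theorem exists_dvr_dominating {k A : Type u} [Field k] [CharZero k] [CommRing A] [IsDomain A]
    [Algebra k A] [Algebra.FiniteType k A] (p : Ideal A) [p.IsPrime] (hp : p ≠ ⊥) :
    ∃ (W : Type u) (_ : CommRing W) (_ : IsDomain W) (_ : IsDiscreteValuationRing W)
      (_ : Algebra k W) (g : A →ₐ[k] W), Function.Injective g ∧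
      ∀ a, g a ∈ maximalIdeal W ↔ a ∈ p := by
  have := Algebra.FiniteType.isNoetherianRing k A
  let Q := FractionRing A
  -- A valuation ring of Q dominating the localization of A at p; it need not be discrete.
  obtain ⟨V, hV, hV'⟩ : ∃ (V : ValuationSubring Q) (h : ∀ a, algebraMap A Q a ∈ V),
      ∀ a, (⟨algebraMap A Q a, h a⟩ : V) ∈ maximalIdeal V ↔ a ∈ p := by
    let f : Localization.AtPrime p →+* Q := IsLocalization.lift (M := p.primeCompl)
      (g := algebraMap A Q) fun y ↦ isUnit_iff_ne_zero.mpr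
        ((map_ne_zero_iff _ (IsFractionRing.injective A Q)).mpr fun h ↦ y.2 (h ▸ p.zero_mem))
    have hf (a : A) : f (algebraMap A _ a) = algebraMap A Q a := IsLocalization.lift_eq _ a
    obtain ⟨V, h, _⟩ := exists_factor_valuationRing f
    refine ⟨V, fun a ↦ hf a ▸ h _, fun a ↦ ?_⟩
    rw [← IsLocalization.AtPrime.to_map_mem_maximal_iff (Localization.AtPrime p) p a,
      mem_maximalIdeal, mem_maximalIdeal, mem_nonunits_iff, mem_nonunits_iff, not_iff_not,
      ← isUnit_map_iff (f.codRestrict V.toSubring h)]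
    exact Eq.to_iff (congrArg IsUnit (Subtype.ext (hf a).symm))
  obtain ⟨T, hT⟩ := IsNoetherian.noetherian p
  have hT0 : T.Nonempty := by
    rw [Finset.nonempty_iff_ne_empty]
    rintro rfl
    exact hp (by simpa using hT.symm)
  -- The generator x of largest value divides all the others in V, so x generates pV.
  obtain ⟨x, hxT, hx⟩ := T.exists_max_image (fun y ↦ V.valuation (algebraMap A Q y)) hT0
  have hxp : x ∈ p := hT ▸ Submodule.subset_span hxT
  have hx0 : algebraMap A Q x ≠ 0 := by
    intro h
    refine hp (hT ▸ Submodule.span_eq_bot.mpr fun y hy ↦ ?_)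
    have := hx y hy
    simpa [h] using this
  -- A chart of the blow-up of p: here p generates the principal ideal (x), and the chart still lies
  -- in V.
  let A' := Algebra.adjoin A ((fun y ↦ algebraMap A Q y / algebraMap A Q x) '' T)
  have hA'V (z : A') : (z : Q) ∈ V := by
    refine Algebra.adjoin_induction (p := fun z _ ↦ z ∈ V) ?_ hV
      (fun _ _ _ _ ↦ V.add_mem _ _) (fun _ _ _ _ ↦ V.mul_mem _ _) z.2
    rintro _ ⟨y, hy, rfl⟩
    rw [← V.valuation_le_one_iff, map_div₀]
    exact div_le_one_of_le₀ (hx y hy) zero_le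
  have : Algebra.FiniteType A A' := .adjoin_of_finite (T.finite_toSet.image _)
  have : Algebra.FiniteType k A' := .trans (S := A) inferInstance inferInstance
  have : IsFractionRing A' Q := IsFractionRing.of_field A' Q fun z ↦ by
    obtain ⟨a, b, -, rfl⟩ := IsFractionRing.div_surjective (A := A) z
    exact ⟨algebraMap A A' a, algebraMap A A' b, rfl⟩
  let B := integralClosure A' Q
  have : IsNoetherianRing B := isNoetherianRing_integralClosure k A' Q
  have : IsIntegrallyClosed B := integralClosure.isIntegrallyClosedOfFiniteExtension Q
  let _ : Algebra A' V := RingHom.toAlgebra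
    { toFun z := ⟨z, hA'V z⟩
      map_zero' := rfl
      map_one' := rfl
      map_add' _ _ := rfl
      map_mul' _ _ := rfl }
  have : IsScalarTower A' V Q := .of_algebraMap_eq fun _ ↦ rfl
  have hBV (z : B) : (z : Q) ∈ V := by
    obtain ⟨y, hy⟩ := IsIntegrallyClosed.isIntegral_iff.mp (z.2.tower_top (A := V))
    exact hy ▸ y.2
  let ι : B →+* V :=
    { toFun z := ⟨z, hBV z⟩
      map_zero' := rfl
      map_one' := rfl
      map_add' _ _ := rfl
      map_mul' _ _ := rfl }
  let j : A →+* B := (algebraMap A' B).comp (algebraMap A A')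
  have hj (a : A) : ι (j a) = ⟨algebraMap A Q a, hV a⟩ := rfl
  -- Choosing q below the center of V keeps q ∩ A inside p. Conversely p ⊆ q, because every
  -- generator of p is a multiple of x in A'.
  obtain ⟨q, hq, hqn⟩ := Ideal.exists_minimalPrimes_le (I := Ideal.span {j x})
    (J := (maximalIdeal V).comap ι) (by
      rw [Ideal.span_singleton_le_iff_mem, Ideal.mem_comap, hj, hV']
      exact hxp)
  have hj0 : Function.Injective j := fun a b h ↦
    IsFractionRing.injective A Q congr(algebraMap B Q $h)
  obtain ⟨W, _, _, _, h, h1, h2⟩ := exists_dvr_of_mem_minimalPrimes (x := j x)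
    ((map_ne_zero_iff j hj0).mpr fun h ↦ hx0 (by rw [h, map_zero])) q hq
  let _ : Algebra k W := ((h.comp j).comp (algebraMap k A)).toAlgebra
  refine ⟨W, inferInstance, inferInstance, inferInstance, inferInstance,
    { h.comp j with commutes' c := rfl }, h1.comp hj0,
    fun a ↦ (h2 _).trans ⟨fun h ↦ ?_, fun h ↦ ?_⟩⟩
  · rw [← hV', ← hj]
    exact hqn h
  · revert a
    change p ≤ q.comap j
    rw [← hT]
    refine Submodule.span_le.mpr fun y hy ↦ ?_
    have hm : algebraMap A Q y / algebraMap A Q x ∈ A' := Algebra.subset_adjoin ⟨y, hy, rfl⟩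
    have : j y = algebraMap A' B ⟨_, hm⟩ * j x :=
      Subtype.ext (div_mul_cancel₀ _ hx0).symm
    change j y ∈ q
    rw [this]
    exact Ideal.mul_mem_left _ _ (hq.1.2 (Ideal.mem_span_singleton_self _))

end DVR

/-! ### The affine case -/

open AlgebraicGeometry CategoryTheory

/-- Every arc of an affine variety, which is not dominant, is a specialization of a dominant arc
centered at the image of its generic point. -/
theorem exists_dominant_generalization {k A K : Type u} [Field k] [CharZero k] [CommRing A]
    [IsDomain A] [Algebra k A] [Algebra.FiniteType k A] [Field K] [Algebra k K]
    (f : A →ₐ[k] K⟦X⟧) (hf : ¬ Function.Injective f) (h : HSAlgebra (algebraMap k A) →+* K)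
    (hh : ∀ n a, h (HSAlgebra.D _ n a) = coeff n (f a)) :
    ∃ (L : Type u) (_ : Field L) (_ : Algebra k L) (ψ : A →ₐ[k] L⟦X⟧)
      (h' : HSAlgebra (algebraMap k A) →+* L), Function.Injective ψ ∧
      (∀ a, constantCoeff (ψ a) = 0 ↔ f a = 0) ∧
      (∀ n a, h' (HSAlgebra.D _ n a) = coeff n (ψ a)) ∧ RingHom.ker h' ≤ RingHom.ker h := by
  let p := RingHom.ker f
  have : p.IsPrime := RingHom.ker_isPrime _
  obtain ⟨W, _, _, _, _, g₁, hg₁, hg₁'⟩ := exists_dvr_dominating (k := k) p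
    (fun e ↦ hf ((RingHom.injective_iff_ker_eq_bot f).mpr e))
  obtain ⟨κ, _, _, g₂, hg₂, hg₂'⟩ := exists_dvr_to_powerSeries k W
  obtain ⟨M, _, _, i, ψ, hi, hψ, hψ', H⟩ := exists_generalization f (g₂.comp g₁) (hg₂.comp hg₁)
    fun a ↦ (hg₂' _).trans (hg₁' a)
  let N := Polynomial M
  let L := FractionRing N
  have hL : Function.Injective (algebraMap N L) := IsFractionRing.injective N L
  -- The classifying map of the family over the affine line; h₁ below classifies the Taylor
  -- expansion over K⟦u⟧.
  let h₀ : HSAlgebra (algebraMap k A) →+* N := HSAlgebra.lift (ψ : A →+* N⟦X⟧) fun n hn c ↦ by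
    simp [ψ.commutes, PowerSeries.algebraMap_apply, coeff_C, hn]
  have hh₀ (n a) : h₀ (HSAlgebra.D _ n a) = coeff n (ψ a) := HSAlgebra.lift_D ..
  let h₁ : HSAlgebra (algebraMap k A) →+* K⟦X⟧ :=
    HSAlgebra.lift ((taylorHom K).comp (f : A →+* K⟦X⟧)) fun n hn c ↦ by
      simp [f.commutes, PowerSeries.algebraMap_apply, coeff_C, hn]
  have hh₁ (n a) : h₁ (HSAlgebra.D _ n a) = coeff n (taylorHom K (f a)) := HSAlgebra.lift_D ..
  -- First specialization, x = 0: from the family to the Taylor expansion.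
  have e₁ : (Polynomial.evalRingHom 0).comp h₀ = i.comp h₁ := HSAlgebra.hom_ext fun n a ↦ by
    have := congr(coeff n ($H a))
    simpa [hh₀, hh₁] using this
  -- Second specialization, u = 0: from the Taylor expansion to the original arc.
  have e₂ : (constantCoeff (R := K)).comp h₁ = h := HSAlgebra.hom_ext fun n a ↦ by
    rw [RingHom.comp_apply, hh₁, hh, ← coeff_map, map_constantCoeff_taylorHom]
  let ψ' : A →ₐ[k] L⟦X⟧ :=
    { (PowerSeries.map (algebraMap N L)).comp (ψ : A →+* N⟦X⟧) with
      commutes' c := by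
        change PowerSeries.map (algebraMap N L) (ψ (algebraMap k A c)) = _
        rw [ψ.commutes, PowerSeries.algebraMap_apply, PowerSeries.algebraMap_apply, map_C,
          ← IsScalarTower.algebraMap_apply] }
  have hψψ (a) : ψ' a = PowerSeries.map (algebraMap N L) (ψ a) := rfl
  refine ⟨L, inferInstance, inferInstance, ψ', (algebraMap N L).comp h₀,
    (PowerSeries.map_injective _ hL).comp hψ, fun a ↦ ?_, fun n a ↦ ?_, fun a ha ↦ ?_⟩
  · rw [hψψ, constantCoeff_map, map_eq_zero_iff _ hL, hψ']
  · rw [RingHom.comp_apply, hh₀, hψψ, coeff_map]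
  · have h0 : h₀ a = 0 := by
      rwa [RingHom.mem_ker, RingHom.comp_apply, map_eq_zero_iff _ hL] at ha
    have h1 : h₁ a = 0 := by
      have := congr($e₁ a)
      rw [RingHom.comp_apply, h0, map_zero, RingHom.comp_apply, eq_comm,
        map_eq_zero_iff _ hi] at this
      exact this
    rw [RingHom.mem_ker, ← e₂, RingHom.comp_apply, h1, map_zero]

/-! ### Passage to schemes and irreducible components -/

section

variable {R : Type u} [CommRing R] {X : Scheme.{u}} {s : X ⟶ Spec (.of R)} {K : Type u} [Field K]

lemma localHom_eq_of_localArc [Algebra R K] (φ : Arc s K) {U : X.Opens} (hU : IsAffineOpen U)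
    (h : HSAlgebra (structMap s U) →+* K) (e : localArc hU h = φ.hom) :
    localHom hU h (fieldPt K) = φ.point := by
  have := φ.existsUnique_hom.unique ((arcOfHom_localHom hU h).trans e)
    φ.existsUnique_hom.choose_spec.1
  rw [Arc.point, ← this]

lemma specializes_localHom {U : X.Opens} (hU : IsAffineOpen U) {L : Type u} [Field L]
    (h : HSAlgebra (structMap s U) →+* K) (h' : HSAlgebra (structMap s U) →+* L)
    (e : RingHom.ker h' ≤ RingHom.ker h) :
    localHom hU h' (fieldPt L) ⤳ localHom hU h (fieldPt K) := by
  rw [localHom, localHom, Scheme.Hom.comp_apply, Scheme.Hom.comp_apply]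
  refine Specializes.map ?_ (chart s hU).continuous
  refine (PrimeSpectrum.le_iff_specializes _ _).mp fun a
    (ha : h' a ∈ IsLocalRing.maximalIdeal L) ↦ ?_
  change h a ∈ IsLocalRing.maximalIdeal K
  simp only [IsLocalRing.mem_maximalIdeal, mem_nonunits_iff, isUnit_iff_ne_zero, not_not] at ha ⊢
  exact e ha

/-- The arc `Spec K⟦t⟧ ⟶ Spec Γ(X, U) ⟶ X` given by a ring homomorphism. -/
noncomputable def arcOfRingHom [Algebra R K] {U : X.Opens} (hU : IsAffineOpen U)
    (f : Γ(X, U) →+* K⟦X⟧) (hf : ∀ c, f (structMap s U c) = algebraMap R K⟦X⟧ c) : Arc s K where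
  hom := Spec.map (CommRingCat.ofHom f) ≫ hU.fromSpec
  hom_comp := by
    rw [Category.assoc, fromSpec_comp, ← Spec.map_comp, ← CommRingCat.ofHom_comp]
    congr 2
    exact RingHom.ext hf

lemma map_genericPt {A : Type u} [CommRing A] (f : A →+* K⟦X⟧) :
    Spec.map (CommRingCat.ofHom f) (genericPt K) = ⟨RingHom.ker f, RingHom.ker_isPrime f⟩ :=
  rfl

lemma map_closedPt {A : Type u} [CommRing A] (f : A →+* K⟦X⟧) :
    Spec.map (CommRingCat.ofHom f) (closedPt K) =
      ⟨RingHom.ker ((constantCoeff (R := K)).comp f), RingHom.ker_isPrime _⟩ := by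
  refine PrimeSpectrum.ext (Ideal.ext fun a ↦ ?_)
  change f a ∈ IsLocalRing.maximalIdeal _ ↔ _
  rw [IsLocalRing.mem_maximalIdeal, mem_nonunits_iff, PowerSeries.isUnit_iff_constantCoeff,
    isUnit_iff_ne_zero, not_not]
  rfl

lemma arc_genericPt_of_injective [IsIntegral X] {U : X.Opens} (hU : IsAffineOpen U) [Nonempty U]
    (f : Γ(X, U) →+* K⟦X⟧) (hf : Function.Injective f) :
    (Spec.map (CommRingCat.ofHom f) ≫ hU.fromSpec) (genericPt K) = genericPoint X := by
  rw [Scheme.Hom.comp_apply, map_genericPt, ← genericPoint_eq_of_isOpenImmersion hU.fromSpec,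
    genericPoint_eq_bot_of_affine]
  congr 1
  exact PrimeSpectrum.ext ((RingHom.injective_iff_ker_eq_bot f).mp hf)

/-- Every `K`-valued point of the space of arcs comes from an arc over `k`. -/
lemma exists_arc_of_hom {k : Type u} [Field k] {s : X ⟶ Spec (.of k)}
    (g : Spec (.of K) ⟶ arcSpace s) :
    ∃ (_ : Algebra k K) (φ : Arc s K), φ.point = g (fieldPt K) := by
  let a : Algebra k K := (Spec.preimage (g ≫ proj s ≫ s)).hom.toAlgebra
  have hg : g ≫ proj s ≫ s = Spec.map (CommRingCat.ofHom (algebraMap k K)) :=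
    (Spec.map_preimage _).symm
  let φ : Arc s K := ⟨arcOfHom g, arcOfHom_over g hg⟩
  refine ⟨a, φ, ?_⟩
  have := φ.existsUnique_hom.unique rfl φ.existsUnique_hom.choose_spec.1
  rw [Arc.point, ← this]

/-- Extending the coefficient field is injective on power series, so it sends the generic point to
the generic point. -/
lemma Arc.arcAt_point_genericPt [Algebra R K] (φ : Arc s K) :
    arcAt φ.point (genericPt _) = φ.hom (genericPt K) := by
  obtain ⟨j, hj⟩ := φ.exists_hom_eq
  rw [hj, Scheme.Hom.comp_apply, map_genericPt]
  congr 1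
  exact (PrimeSpectrum.ext ((RingHom.injective_iff_ker_eq_bot _).mp
    (PowerSeries.map_injective j j.injective))).symm

lemma isClosed_sing {k : Type u} [Field k] (s : X ⟶ Spec (.of k)) [LocallyOfFiniteType s] :
    IsClosed (sing s) := by
  rw [sing]
  exact (Scheme.Hom.smoothLocus s).isOpen.isClosed_compl

lemma genericPoint_notMem_sing {k : Type u} [Field k] [CharZero k] [IsIntegral X]
    (s : X ⟶ Spec (.of k)) [LocallyOfFiniteType s] : genericPoint X ∉ sing s := by
  have : LocallyOfFinitePresentation s :=
    LocallyOfFinitePresentation.iff_locallyOfFiniteType.mpr inferInstance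
  exact fun h ↦ h s.genericPoint_mem_smoothLocus_of_perfectField

/-- Every arc through `Sing X` is a specialization of such an arc with generic point outside
`Sing X`. -/
theorem exists_generalization_of_arc {k : Type u} [Field k] [CharZero k] [IsIntegral X]
    (s : X ⟶ Spec (.of k)) [LocallyOfFiniteType s] [Algebra k K] (φ : Arc s K)
    (hφ : φ.hom (closedPt K) ∈ sing s) :
    ∃ (L : Type u) (_ : Field L) (_ : Algebra k L) (ψ : Arc s L),
      ψ.hom (closedPt L) ∈ sing s ∧ ψ.hom (genericPt L) ∉ sing s ∧ ψ.point ⤳ φ.point := by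
  by_cases hη : φ.hom (genericPt K) ∈ sing s
  swap
  · exact ⟨K, inferInstance, inferInstance, φ, hφ, hη, specializes_rfl⟩
  obtain ⟨U, hU, hx⟩ := exists_affine_mem (φ.hom (closedPt K))
  have : Nonempty U := ⟨⟨_, hx⟩⟩
  obtain ⟨f, hf⟩ := exists_arc_factor φ.hom hU hx
  let _ : Algebra k Γ(X, U) := (structMap s U).toAlgebra
  have : Algebra.FiniteType k Γ(X, U) := by
    have : LocallyOfFiniteType (Spec.map (CommRingCat.ofHom (structMap s U))) := by
      rw [← fromSpec_comp s hU]
      infer_instance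
    exact (HasRingHomProperty.Spec_iff (P := @LocallyOfFiniteType)).mp this
  have hfc (c : k) : f (structMap s U c) = algebraMap k K⟦X⟧ c := by
    have := φ.hom_comp
    rw [← hf, Category.assoc, fromSpec_comp, ← Spec.map_comp] at this
    exact congr(($(Spec.map_injective this)).hom c)
  let f' : Γ(X, U) →ₐ[k] K⟦X⟧ := { f with commutes' := hfc }
  -- An injective f would send η to the generic point of X, which is smooth.
  have hfi : ¬ Function.Injective f' := fun h ↦ by
    rw [← hf, arc_genericPt_of_injective hU f h] at hη
    exact genericPoint_notMem_sing s hη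
  let h : HSAlgebra (structMap s U) →+* K := HSAlgebra.lift f fun n hn c ↦ by
    rw [hfc, PowerSeries.algebraMap_apply, coeff_C, if_neg hn]
  have hh : localArc hU h = φ.hom := by
    rw [localArc, HSAlgebra.map_lift_comp_univ, hf]
  obtain ⟨L, _, _, ψ, h', hψ, hψ0, hψh, hker⟩ :=
    exists_dominant_generalization f' hfi h fun n a ↦ HSAlgebra.lift_D ..
  let ψ' : Arc s L := arcOfRingHom hU ψ ψ.commutes
  refine ⟨L, inferInstance, inferInstance, ψ', ?_, ?_, ?_⟩
  -- The center of the new arc is φ(η), since the constant terms of ψ vanish exactly on the kernel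
  -- of f.
  · convert! hη using 1
    rw [← hf]
    change (Spec.map (CommRingCat.ofHom (ψ : Γ(X, U) →+* L⟦X⟧)) ≫ hU.fromSpec) _ = _
    rw [Scheme.Hom.comp_apply, Scheme.Hom.comp_apply, map_genericPt, map_closedPt]
    congr 1
    exact PrimeSpectrum.ext (Ideal.ext hψ0)
  · rw [show ψ'.hom (genericPt L) = genericPoint X from
      arc_genericPt_of_injective hU (ψ : Γ(X, U) →+* L⟦X⟧) hψ]
    exact genericPoint_notMem_sing s
  · have hh' : localArc hU h' = ψ'.hom := by
      rw [localArc]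
      congr 3
      ext a n
      rw [RingHom.comp_apply, coeff_map, HSAlgebra.coeff_univ]
      exact hψh n a
    rw [← localHom_eq_of_localArc φ hU h hh, ← localHom_eq_of_localArc ψ' hU h' hh']
    exact specializes_localHom hU h h' hker

/-- Every irreducible component of the space of arcs through `Sing X` is good. -/
theorem isGood_of_mem_irreducibleComponents {k : Type u} [Field k] [CharZero k] [IsIntegral X]
    (s : X ⟶ Spec (.of k)) [LocallyOfFiniteType s] (C : Set (arcsThroughSing s))
    (hC : C ∈ irreducibleComponents (arcsThroughSing s)) : IsGood C := by
  have hcl : IsClosed (arcsThroughSing s) := (isClosed_sing s).preimage (proj s).continuous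
  have : QuasiSober (arcsThroughSing s) := hcl.isClosedEmbedding_subtypeVal.quasiSober
  obtain ⟨x, hx⟩ := QuasiSober.sober hC.1 (isClosed_of_mem_irreducibleComponents C hC)
  obtain ⟨_, φ, hφx⟩ := exists_arc_of_hom ((arcSpace s).fromSpecResidueField x.1)
  replace hφx : φ.point = x.1 := hφx.trans (Scheme.fromSpecResidueField_apply x.1 _)
  obtain ⟨L, _, _, ψ, h0, hη, hψ⟩ := exists_generalization_of_arc s φ (by
    rw [← φ.proj_point, hφx]
    exact x.2)
  let y : arcsThroughSing s := ⟨ψ.point, by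
    rw [arcsThroughSing, Set.mem_preimage, ψ.proj_point]
    exact h0⟩
  have hyx : y ⤳ x := by
    rw [subtype_specializes_iff, ← hφx]
    exact hψ
  -- C is the closure of x and y specializes to x, so the closure of y contains C. By maximality it
  -- equals C, hence y ∈ C.
  refine ⟨y, hC.2 isIrreducible_singleton.closure ?_ (subset_closure rfl), ?_⟩
  · rw [← hx.def]
    exact hyx.closure_subset
  · rw [ψ.arcAt_point_genericPt]
    exact hη

end

end ArcSpace

theorem mainTheorem5 {k : Type u} [Field k] [CharZero k]
    {X : AlgebraicGeometry.Scheme.{u}} (s : X ⟶ AlgebraicGeometry.Spec (.of k))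
    [AlgebraicGeometry.IsIntegral X] [AlgebraicGeometry.IsSeparated s]
    [AlgebraicGeometry.LocallyOfFiniteType s] [AlgebraicGeometry.QuasiCompact s] :
    (∀ (K : Type u) [Field K] [Algebra k K] (φ : ArcSpace.Arc s K),
      φ.hom (ArcSpace.closedPt K) ∈ ArcSpace.sing s →
      ∃ (L : Type u) (_ : Field L) (_ : Algebra k L) (ψ : ArcSpace.Arc s L),
        ψ.hom (ArcSpace.closedPt L) ∈ ArcSpace.sing s ∧
        ψ.hom (ArcSpace.genericPt L) ∉ ArcSpace.sing s ∧
        Specializes ψ.point φ.point) ∧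
    (∀ C ∈ irreducibleComponents (ArcSpace.arcsThroughSing s), ArcSpace.IsGood C) :=
  ⟨fun _ _ _ φ hφ ↦ ArcSpace.exists_generalization_of_arc s φ hφ,
    ArcSpace.isGood_of_mem_irreducibleComponents s⟩
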